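/- Let $G$ be a connected finite-dimensional (real, smooth) Lie group with Lie algebra $\mathfrak g=T_eG$, and let $q\colon\mathfrak g\to\mathfrak a$ be the quotient map onto its abelianisation $\mathfrak a=\mathfrak g^{ab}=\mathfrak g/[\mathfrak g,\mathfrak g]$. Let $\Omega^2_I(G)$ denote the vector space of bi-invariant $2$-forms on $G$, that is, of smooth differential $2$-forms $\eta$ with $L_g^*\eta=\eta=R_g^*\eta$ for all $g\in G$, where $L_g$ and $R_g$ are left and right translation by $g$. Then there is a linear isomorphism $$\Phi\colon \Omega^2_I(G)\xrightarrow{\ \simeq\ }\textstyle\bigwedge^2\mathfrak a^*,$$ characterised, when elements of $\bigwedge^2\mathfrak a^*$ are regarded as alternating bilinear forms on $\mathfrak a$ by $(\alpha\wedge\beta)(v,w)=\alpha(v)\beta(w)-\alpha(w)\beta(v)$, by $$\Phi(\eta)(q(X),q(Y))=\eta_e(X,Y)\qquad\text{for all } X,Y\in\mathfrak g .$$ If moreover $G$ is compact, then $\mathfrak a$ is the largest abelian direct summand of $\mathfrak g$: among the abelian ideals $\mathfrak b\subseteq\mathfrak g$ that admit a complementary ideal $\mathfrak c$ (so $\mathfrak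 g=\mathfrak b\oplus\mathfrak c$ as Lie algebras), there is one, $\mathfrak z$, that contains all the others, and $q$ restricts to an isomorphism of Lie algebras $\mathfrak z\xrightarrow{\ \simeq\ }\mathfrak a$. -/

import Mathlib

open scoped Manifold ContDiff

/-- A smooth real Lie group is in particular regular enough for its Lie algebra to be defined. -/
instance instLEInftyMinSmoothnessRealThree : ENat.LEInfty (minSmoothness ℝ 3) :=
  ⟨by
    rw [minSmoothness_of_isRCLikeNormedField]
    exact ENat.LEInfty.out⟩

/-- `Ω^k(M)`: smooth differential `k`-forms on `M`, i.e. smooth sections of the vector bundle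
whose fibre at `x` is the space of alternating `k`-linear maps from `T_x M` to `ℝ`. -/
abbrev SmoothForm {E : Type*} [NormedAddCommGroup E] [NormedSpace ℝ E]
    {H : Type*} [TopologicalSpace H] (I : ModelWithCorners ℝ E H)
    (M : Type*) [TopologicalSpace M] [ChartedSpace H M] [IsManifold I ∞ M] (k : ℕ) : Type _ :=
  ContMDiffSection I (E [⋀^Fin k]→L[ℝ] ℝ) ∞
    (fun x : M => TangentSpace I x [⋀^Fin k]→L[ℝ] Bundle.Trivial M ℝ x)

/-- The value at `x` of the pullback `f^* η`, i.e.
`(f^* η)_x (v₁, …, v_k) = η_{f x} (df_x v₁, …, df_x v_k)`. -/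
noncomputable def SmoothForm.pullbackAt {E : Type*} [NormedAddCommGroup E] [NormedSpace ℝ E]
    {H : Type*} [TopologicalSpace H] {I : ModelWithCorners ℝ E H}
    {M : Type*} [TopologicalSpace M] [ChartedSpace H M] [IsManifold I ∞ M] {k : ℕ}
    (f : M → M) (η : SmoothForm I M k) (x : M) : TangentSpace I x [⋀^Fin k]→L[ℝ] ℝ :=
  (η (f x)).compContinuousLinearMap (mfderiv I I f x)

/-- `Ω^k_I(G)`: the space of bi-invariant `k`-forms on `G`, i.e. of the smooth `k`-forms `η` with
`L_g^* η = η = R_g^* η` for all `g`. -/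
noncomputable def biInvariantForms {E : Type*} [NormedAddCommGroup E] [NormedSpace ℝ E]
    {H : Type*} [TopologicalSpace H] (I : ModelWithCorners ℝ E H)
    (G : Type*) [TopologicalSpace G] [ChartedSpace H G] [Group G] [LieGroup I ∞ G] (k : ℕ) :
    Submodule ℝ (SmoothForm I G k) where
  carrier := {η | ∀ g : G,
    (∀ x, SmoothForm.pullbackAt (fun y => g * y) η x = η x) ∧
    (∀ x, SmoothForm.pullbackAt (fun y => y * g) η x = η x)}
  zero_mem' := fun _ => ⟨fun _ => by ext; rfl, fun _ => by ext; rfl⟩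
  add_mem' := by
    intro a b ha hb g
    refine ⟨fun x => ?_, fun x => ?_⟩
    · exact congrArg₂ (· + ·) ((ha g).1 x) ((hb g).1 x)
    · exact congrArg₂ (· + ·) ((ha g).2 x) ((hb g).2 x)
  smul_mem' := by
    intro c a ha g
    refine ⟨fun x => ?_, fun x => ?_⟩
    · exact congrArg (c • ·) ((ha g).1 x)
    · exact congrArg (c • ·) ((ha g).2 x)

/-- The commutator ideal `[L, L]` of a real Lie algebra. -/
abbrev lieCommutator (L : Type*) [LieRing L] [LieAlgebra ℝ L] : LieIdeal ℝ L :=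
  ⁅(⊤ : LieIdeal ℝ L), (⊤ : LieIdeal ℝ L)⁆

/-- The abelianisation `L^ab = L / [L, L]` of a real Lie algebra. -/
abbrev LieAb (L : Type*) [LieRing L] [LieAlgebra ℝ L] : Type _ := L ⧸ lieCommutator L

/-- The quotient map `L → L^ab`. -/
abbrev LieAb.mk {L : Type*} [LieRing L] [LieAlgebra ℝ L] (x : L) : LieAb L :=
  LieSubmodule.Quotient.mk x

/-- An ideal `𝔟` of `L` is an abelian direct summand if it is abelian and `L = 𝔟 ⊕ 𝔠` as Lie
algebras, for some ideal `𝔠`. -/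
def IsAbelianDirectSummand {L : Type*} [LieRing L] [LieAlgebra ℝ L] (𝔟 : LieIdeal ℝ L) : Prop :=
  IsLieAbelian 𝔟 ∧ ∃ 𝔠 : LieIdeal ℝ L, IsCompl 𝔟 𝔠

open scoped Topology
open Set Filter

section ModelDerivative

variable {E : Type*} [NormedAddCommGroup E] [NormedSpace ℝ E]
  {H : Type*} [TopologicalSpace H] {I : ModelWithCorners ℝ E H}
  {G : Type*} [TopologicalSpace G] [ChartedSpace H G]

variable (I) in
/-- The manifold derivative of a self-map, seen as an endomorphism of the model space; its type
does not depend on the base point. -/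
noncomputable def modelDeriv (f : G → G) (x : G) : E →L[ℝ] E := mfderiv I I f x

theorem modelDeriv_comp {f g : G → G} (x : G) (hf : MDifferentiableAt I I f (g x))
    (hg : MDifferentiableAt I I g x) :
    modelDeriv I (f ∘ g) x = modelDeriv I f (g x) ∘L modelDeriv I g x :=
  mfderiv_comp (I' := I) x hf hg

theorem modelDeriv_id (x : G) : modelDeriv I (id : G → G) x = ContinuousLinearMap.id ℝ E :=
  mfderiv_id

theorem continuousLinearMapAt_trivializationAt_self [IsManifold I 1 G] (x : G) :
    ((trivializationAt E (TangentSpace I) x).continuousLinearMapAt ℝ x : E →L[ℝ] E) =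
      ContinuousLinearMap.id ℝ E :=
  (TangentBundle.continuousLinearMapAt_trivializationAt (I := I) (mem_chart_source H x)).trans
    mfderiv_extChartAt_self

theorem symmL_trivializationAt_self [IsManifold I 1 G] (x : G) :
    ((trivializationAt E (TangentSpace I) x).symmL ℝ x : E →L[ℝ] E) =
      ContinuousLinearMap.id ℝ E :=
  (TangentBundle.symmL_trivializationAt (I := I) (mem_chart_source H x)).trans
    mfderivWithin_range_extChartAt_symm

end ModelDerivative

section Adjoint

variable {E : Type*} [NormedAddCommGroup E] [NormedSpace ℝ E]
  {H : Type*} [TopologicalSpace H] {I : ModelWithCorners ℝ E H}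
  {G : Type*} [TopologicalSpace G] [ChartedSpace H G] [Group G]

variable (I) in
/-- The adjoint representation, as a continuous linear map of the model space. -/
noncomputable def adjointMap (g : G) : E →L[ℝ] E := modelDeriv I (fun x : G => g * x * g⁻¹) 1

theorem adjointMap_one : adjointMap I (1 : G) = ContinuousLinearMap.id ℝ E := by
  have e : (fun y : G => 1 * y * 1⁻¹) = id := by ext y; simp
  rw [adjointMap, e, modelDeriv_id]

variable [LieGroup I ∞ G]

theorem mdifferentiableAt_mul_left' (g x : G) : MDifferentiableAt I I (fun y => g * y) x :=
  (contMDiff_mul_left (I := I) (n := ∞) (a := g)).mdifferentiable (by simp) x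

theorem mdifferentiableAt_mul_right' (g x : G) : MDifferentiableAt I I (fun y => y * g) x :=
  (contMDiff_mul_right (I := I) (n := ∞) (a := g)).mdifferentiable (by simp) x

theorem mdifferentiableAt_conj (g x : G) :
    MDifferentiableAt I I (fun y => g * y * g⁻¹) x :=
  (mdifferentiableAt_mul_right' (I := I) g⁻¹ (g * x)).comp x (mdifferentiableAt_mul_left' g x)

/-- `L_g = R_g ∘ c_g` on tangent vectors at the identity. -/
theorem modelDeriv_mul_left_eq_comp_adjointMap (g : G) :
    modelDeriv I (fun y => g * y) (1 : G) =
      modelDeriv I (fun y => y * g) (1 : G) ∘L adjointMap I g := by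
  have h : (fun y : G => g * y) = (fun y => y * g) ∘ (fun y => g * y * g⁻¹) := by
    ext y; simp
  rw [h, modelDeriv_comp _ (mdifferentiableAt_mul_right' g _) (mdifferentiableAt_conj g 1)]
  simp [adjointMap]

theorem adjointMap_mul (g h : G) : adjointMap I (g * h) = adjointMap I g ∘L adjointMap I h := by
  have e : (fun y : G => g * h * y * (g * h)⁻¹) =
      (fun y => g * y * g⁻¹) ∘ (fun y => h * y * h⁻¹) := by
    ext y; simp [mul_assoc]
  rw [adjointMap, e, modelDeriv_comp _ (mdifferentiableAt_conj g _) (mdifferentiableAt_conj h 1)]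
  simp [adjointMap]

theorem contMDiff_adjointMap : ContMDiff I 𝓘(ℝ, E →L[ℝ] E) ∞ (adjointMap I : G → E →L[ℝ] E) := by
  have : IsManifold I 1 G := IsManifold.of_le (n := ∞) (by simp)
  intro g₀
  have hf : ContMDiffAt (I.prod I) I ∞
      (Function.uncurry fun (g x : G) => g * x * g⁻¹) (g₀, (1 : G)) := by
    have h1 : ContMDiff (I.prod I) I ∞ (fun p : G × G => p.1 * p.2) :=
      contMDiff_fst.mul contMDiff_snd
    exact (h1.mul contMDiff_fst.inv).contMDiffAt
  have := ContMDiffAt.mfderiv (m := ∞) (fun (g x : G) => g * x * g⁻¹) (fun _ => (1 : G)) hf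
    contMDiffAt_const (by simp)
  refine this.congr_of_eventuallyEq (Eventually.of_forall fun g => ?_)
  have key : ∀ h k : G, h = 1 → k = 1 →
      ((trivializationAt E (TangentSpace I) k).continuousLinearMapAt ℝ h : E →L[ℝ] E) =
        ContinuousLinearMap.id ℝ E := by
    rintro _ _ rfl rfl; exact continuousLinearMapAt_trivializationAt_self _
  ext v
  refine Eq.symm ?_
  refine (congrArg (fun L : E →L[ℝ] E => L _) (key (g * 1 * g⁻¹) (g₀ * 1 * g₀⁻¹)
    (by simp) (by simp))).trans ?_
  exact congrArg (fun w : E => adjointMap I g w) (congrArg (fun L : E →L[ℝ] E => L v)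
    (symmL_trivializationAt_self (I := I) (1 : G)))

end Adjoint

section LocallyConstant

/-- On a boundaryless manifold, a differentiable function whose derivative vanishes is locally
constant. -/
theorem isLocallyConstant_of_mfderiv_eq_zero {E : Type*} [NormedAddCommGroup E] [NormedSpace ℝ E]
    {H : Type*} [TopologicalSpace H] {I : ModelWithCorners ℝ E H} [I.Boundaryless]
    {M : Type*} [TopologicalSpace M] [ChartedSpace H M] [IsManifold I 1 M]
    {F : Type*} [NormedAddCommGroup F] [NormedSpace ℝ F] {f : M → F}
    (hf : MDifferentiable I 𝓘(ℝ, F) f) (h0 : ∀ x, mfderiv I 𝓘(ℝ, F) f x = 0) :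
    IsLocallyConstant f := by
  rw [IsLocallyConstant.iff_eventually_eq]
  intro x
  set φ := extChartAt I x
  have htar : IsOpen φ.target := isOpen_extChartAt_target x
  obtain ⟨r, hr, hball⟩ := Metric.isOpen_iff.1 htar (φ x) (mem_extChartAt_target x)
  have hd : ∀ y ∈ φ.target, HasFDerivAt (f ∘ φ.symm) (0 : E →L[ℝ] F) y := by
    intro y hy
    have h1 : MDifferentiableAt 𝓘(ℝ, E) I φ.symm y := by
      have := mdifferentiableWithinAt_extChartAt_symm (I := I) hy
      rwa [I.range_eq_univ, mdifferentiableWithinAt_univ] at this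
    have h2 := ((hf (φ.symm y)).hasMFDerivAt.comp y h1.hasMFDerivAt).hasFDerivAt
    rw [h0] at h2
    convert h2
    simp; rfl
  have hc : ∀ y ∈ Metric.ball (φ x) r, (f ∘ φ.symm) y = (f ∘ φ.symm) (φ x) := by
    intro y hy
    refine (convex_ball (φ x) r).is_const_of_fderivWithin_eq_zero (𝕜 := ℝ)
      (fun z hz => (hd z (hball hz)).differentiableAt.differentiableWithinAt) ?_ hy
      (Metric.mem_ball_self hr)
    intro z hz
    rw [fderivWithin_of_isOpen Metric.isOpen_ball hz]
    exact (hd z (hball hz)).fderiv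
  filter_upwards [(continuousAt_extChartAt (I := I) x).preimage_mem_nhds
    (Metric.ball_mem_nhds _ hr), extChartAt_source_mem_nhds (I := I) x] with y hy hys
  have := hc (φ y) hy
  simpa [φ.left_inv hys, φ.left_inv (mem_extChartAt_source x)] using this

end LocallyConstant

section ChartLaw

variable {E : Type*} [NormedAddCommGroup E] [NormedSpace ℝ E]
  {H : Type*} [TopologicalSpace H] {I : ModelWithCorners ℝ E H}
  {G : Type*} [TopologicalSpace G] [ChartedSpace H G] [Group G]

variable (I G) in
/-- The group law read in the preferred chart at the identity. -/
noncomputable def chartLaw (p : E × E) : E :=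
  extChartAt I (1 : G) ((extChartAt I (1 : G)).symm p.1 * (extChartAt I (1 : G)).symm p.2)

variable (I) in
/-- The derivative of the preferred chart at the identity. -/
noncomputable def chartDeriv (g : G) : E →L[ℝ] E :=
  mfderiv I 𝓘(ℝ, E) (extChartAt I (1 : G)) g

variable [I.Boundaryless] [LieGroup I ∞ G]

theorem contDiffAt_chartLaw :
    ContDiffAt ℝ ∞ (chartLaw I G) (extChartAt I (1 : G) 1, extChartAt I (1 : G) 1) := by
  have hsymm : ContMDiffAt 𝓘(ℝ, E) I ∞ (extChartAt I (1 : G)).symm (extChartAt I (1 : G) 1) :=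
    (contMDiffOn_extChartAt_symm (I := I) (n := ∞) (1 : G)).contMDiffAt
      ((isOpen_extChartAt_target (I := I) (1 : G)).mem_nhds (mem_extChartAt_target (I := I) (1 : G)))
  have h1 : ContMDiffAt 𝓘(ℝ, E × E) I ∞
      (fun p : E × E => (extChartAt I (1 : G)).symm p.1 * (extChartAt I (1 : G)).symm p.2)
      (extChartAt I (1 : G) 1, extChartAt I (1 : G) 1) :=
    (hsymm.comp (extChartAt I (1 : G) 1, extChartAt I (1 : G) 1)
      contDiff_fst.contMDiff.contMDiffAt).mul
    (hsymm.comp (extChartAt I (1 : G) 1, extChartAt I (1 : G) 1)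
      contDiff_snd.contMDiff.contMDiffAt)
  have h2 : ContMDiffAt I 𝓘(ℝ, E) ∞ (extChartAt I (1 : G))
      ((extChartAt I (1 : G)).symm (extChartAt I (1 : G) 1) *
        (extChartAt I (1 : G)).symm (extChartAt I (1 : G) 1)) := by
    rw [extChartAt_to_inv, one_mul]
    exact contMDiffAt_extChartAt
  exact (h2.comp (extChartAt I (1 : G) 1, extChartAt I (1 : G) 1) h1).contDiffAt

theorem eventually_differentiableAt_chartLaw :
    ∀ᶠ p in 𝓝 (extChartAt I (1 : G) 1, extChartAt I (1 : G) 1),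
      DifferentiableAt ℝ (chartLaw I G) p := by
  have := ((contDiffAt_chartLaw (I := I) (G := G)).of_le (m := 1) (by simp)).eventually (by simp)
  exact this.mono fun p hp => hp.differentiableAt (by simp)

/-- Chain rule for a self-map of `G` fixing the base point of the chart, read through the chart. -/
theorem hasFDerivAt_chart_comp {L : G → G} {g : G} (hL : MDifferentiableAt I I L 1)
    (hg : L 1 = g) (hgs : g ∈ (chartAt H (1 : G)).source) :
    HasFDerivAt (fun y => extChartAt I (1 : G) (L ((extChartAt I (1 : G)).symm y)))
      (chartDeriv I g ∘L modelDeriv I L 1) (extChartAt I (1 : G) 1) := by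
  subst hg
  have h1 : HasMFDerivAt 𝓘(ℝ, E) I (extChartAt I (1 : G)).symm (extChartAt I (1 : G) 1)
      (ContinuousLinearMap.id ℝ E) := by
    have := mdifferentiableWithinAt_extChartAt_symm (I := I) (mem_extChartAt_target (I := I) (1 : G))
    have e := mfderivWithin_range_extChartAt_symm (I := I) (x := (1 : G))
    rw [I.range_eq_univ, mdifferentiableWithinAt_univ] at this
    rw [I.range_eq_univ, mfderivWithin_univ] at e
    have h := this.hasMFDerivAt
    exact e ▸ h
  have h2 : ∀ h : G, h = 1 → HasMFDerivAt I I L h (modelDeriv (E := E) I L 1) := by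
    rintro _ rfl; exact hL.hasMFDerivAt
  have h3 : ∀ h : G, h = L 1 → HasMFDerivAt I 𝓘(ℝ, E) (extChartAt I (1 : G)) h
      (chartDeriv (E := E) I (L 1)) := by
    rintro _ rfl; exact (mdifferentiableAt_extChartAt hgs).hasMFDerivAt
  have e1 : (extChartAt I (1 : G)).symm (extChartAt I (1 : G) 1) = 1 := extChartAt_to_inv _
  have := HasMFDerivAt.comp (f := L ∘ (extChartAt I (1 : G)).symm) (extChartAt I (1 : G) 1)
    (h3 _ (congrArg L e1)) ((h2 _ e1).comp _ h1)
  exact this.hasFDerivAt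

theorem fderiv_chartLaw_inr {x : E} (hx : x ∈ (extChartAt I (1 : G)).target)
    (hd : DifferentiableAt ℝ (chartLaw I G) (x, extChartAt I (1 : G) 1)) (v : E) :
    fderiv ℝ (chartLaw I G) (x, extChartAt I (1 : G) 1) (0, v) =
      chartDeriv I ((extChartAt I (1 : G)).symm x)
        (modelDeriv I (fun y => (extChartAt I (1 : G)).symm x * y) (1 : G) v) := by
  have hs : (extChartAt I (1 : G)).symm x ∈ (chartAt H (1 : G)).source := by
    rw [← extChartAt_source I]; exact (extChartAt I (1 : G)).map_target hx
  have h1 := hasFDerivAt_chart_comp (I := I)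
    (mdifferentiableAt_mul_left' (I := I) ((extChartAt I (1 : G)).symm x) 1) (mul_one _) hs
  have h2 := hd.hasFDerivAt.comp (extChartAt I (1 : G) 1)
    (hasFDerivAt_prodMk_right x (extChartAt I (1 : G) 1))
  exact congrArg (fun L : E →L[ℝ] E => L v) (h2.unique h1)

theorem fderiv_chartLaw_inl {x : E} (hx : x ∈ (extChartAt I (1 : G)).target)
    (hd : DifferentiableAt ℝ (chartLaw I G) (extChartAt I (1 : G) 1, x)) (v : E) :
    fderiv ℝ (chartLaw I G) (extChartAt I (1 : G) 1, x) (v, 0) =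
      chartDeriv I ((extChartAt I (1 : G)).symm x)
        (modelDeriv I (fun y => y * (extChartAt I (1 : G)).symm x) (1 : G) v) := by
  have hs : (extChartAt I (1 : G)).symm x ∈ (chartAt H (1 : G)).source := by
    rw [← extChartAt_source I]; exact (extChartAt I (1 : G)).map_target hx
  have h1 := hasFDerivAt_chart_comp (I := I)
    (mdifferentiableAt_mul_right' (I := I) ((extChartAt I (1 : G)).symm x) 1) (one_mul _) hs
  have h2 := HasFDerivAt.comp (f := fun y : E => (y, x)) (extChartAt I (1 : G) 1) hd.hasFDerivAt
    (hasFDerivAt_prodMk_left (extChartAt I (1 : G) 1) x)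
  exact congrArg (fun L : E →L[ℝ] E => L v) (h2.unique h1)

omit [I.Boundaryless] in
theorem chartDeriv_one : chartDeriv I (1 : G) = ContinuousLinearMap.id ℝ E :=
  have : IsManifold I 1 G := IsManifold.of_le (n := ∞) (by simp)
  mfderiv_extChartAt_self

/-- A left-invariant vector field, read in the chart at the identity. -/
theorem mpullbackWithin_mulInvariantVectorField_eq {x : E}
    (hx : x ∈ (extChartAt I (1 : G)).target)
    (hd : DifferentiableAt ℝ (chartLaw I G) (x, extChartAt I (1 : G) 1))
    (v : E) :
    VectorField.mpullbackWithin 𝓘(ℝ, E) I (extChartAt I (1 : G)).symm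
      (mulInvariantVectorField (I := I) (G := G) v) (range I) x =
      fderiv ℝ (chartLaw I G) (x, extChartAt I (1 : G) 1) (0, v) := by
  have : IsManifold I 1 G := IsManifold.of_le (n := ∞) (by simp)
  refine Eq.trans ?_ (fderiv_chartLaw_inr hx hd v).symm
  rw [VectorField.mpullbackWithin_apply]
  have hinv : (mfderivWithin 𝓘(ℝ, E) I (extChartAt I (1 : G)).symm (range I) x).inverse =
      mfderiv I 𝓘(ℝ, E) (extChartAt I (1 : G)) ((extChartAt I (1 : G)).symm x) :=
    ContinuousLinearMap.inverse_eq (mfderivWithin_extChartAt_symm_comp_mfderiv_extChartAt hx)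
      (mfderiv_extChartAt_comp_mfderivWithin_extChartAt_symm hx)
  refine (congrArg (fun L : E →L[ℝ] E => L (mulInvariantVectorField (I := I) (G := G) v
    ((extChartAt I (1 : G)).symm x) : E)) hinv).trans ?_
  rfl

/-- In the chart at the identity, the derivative of the adjoint representation along `z` is the
antisymmetrisation of the second derivative of the group law. -/
theorem fderiv_adjointMap_chart (z v : E) :
    fderiv ℝ (fun x => adjointMap I ((extChartAt I (1 : G)).symm x)) (extChartAt I (1 : G) 1) z v =
      fderiv ℝ (fderiv ℝ (chartLaw I G)) (extChartAt I (1 : G) 1, extChartAt I (1 : G) 1)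
        (z, 0) (0, v) -
      fderiv ℝ (fderiv ℝ (chartLaw I G)) (extChartAt I (1 : G) 1, extChartAt I (1 : G) 1)
        (0, z) (v, 0) := by
  set e₀ := extChartAt I (1 : G) 1 with he₀
  have e1 : (extChartAt I (1 : G)).symm e₀ = 1 := extChartAt_to_inv _
  have hA : DifferentiableAt ℝ (fun x => adjointMap I ((extChartAt I (1 : G)).symm x)) e₀ := by
    have hsymm : ContMDiffAt 𝓘(ℝ, E) I ∞ (extChartAt I (1 : G)).symm e₀ :=
      (contMDiffOn_extChartAt_symm (I := I) (n := ∞) (1 : G)).contMDiffAt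
        ((isOpen_extChartAt_target (I := I) (1 : G)).mem_nhds
          (mem_extChartAt_target (I := I) (1 : G)))
    have := ((contMDiff_adjointMap (I := I) (G := G)).contMDiffAt.comp e₀ hsymm).contDiffAt
    exact this.differentiableAt (by simp)
  have hD : DifferentiableAt ℝ (fderiv ℝ (chartLaw I G)) (e₀, e₀) :=
    ((contDiffAt_chartLaw (I := I) (G := G)).fderiv_right (m := 1)
      (by rw [one_add_one_eq_two]; exact ENat.LEInfty.out)).differentiableAt (by simp)
  have hl := (HasFDerivAt.comp (f := fun y : E => (y, e₀)) e₀ hD.hasFDerivAt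
      (hasFDerivAt_prodMk_left e₀ e₀)).clm_apply
    (hasFDerivAt_const ((0, v) : E × E) e₀)
  have hr' := HasFDerivAt.comp (f := fun y : E => (e₀, y)) e₀ hD.hasFDerivAt
    (hasFDerivAt_prodMk_right e₀ e₀)
  have hAv : HasFDerivAt (fun x => (adjointMap I ((extChartAt I (1 : G)).symm x) v, (0 : E)))
      (ContinuousLinearMap.inl ℝ E E ∘L
        (fderiv ℝ (fun x => adjointMap I ((extChartAt I (1 : G)).symm x)) e₀).flip v) e₀ := by
    have := hA.hasFDerivAt.clm_apply (hasFDerivAt_const v e₀)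
    have := (ContinuousLinearMap.inl ℝ E E).hasFDerivAt.comp e₀ this
    convert! this using 1
    ext <;> simp
  have hr := hr'.clm_apply hAv
  have hev : (fun x => fderiv ℝ (chartLaw I G) (x, e₀) (0, v)) =ᶠ[𝓝 e₀]
      fun x => fderiv ℝ (chartLaw I G) (e₀, x)
        (adjointMap I ((extChartAt I (1 : G)).symm x) v, 0) := by
    have hd := eventually_differentiableAt_chartLaw (I := I) (G := G)
    have c1 : ContinuousAt (fun x : E => (x, e₀)) e₀ := by fun_prop
    have c2 : ContinuousAt (fun x : E => (e₀, x)) e₀ := by fun_prop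
    filter_upwards [(isOpen_extChartAt_target (I := I) (1 : G)).mem_nhds
      (mem_extChartAt_target (I := I) (1 : G)), c1.eventually hd, c2.eventually hd]
      with x hx h1 h2
    rw [fderiv_chartLaw_inr hx h1, fderiv_chartLaw_inl hx h2,
      modelDeriv_mul_left_eq_comp_adjointMap]
    rfl
  have huniq := congrArg (fun L : E →L[ℝ] E => L z)
    ((hl.congr_of_eventuallyEq hev.symm).unique hr)
  have hid : ∀ w : E, fderiv ℝ (chartLaw I G) (e₀, e₀) (w, 0) = w := by
    intro w
    have hd := (eventually_differentiableAt_chartLaw (I := I) (G := G)).self_of_nhds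
    rw [fderiv_chartLaw_inl (mem_extChartAt_target (I := I) (1 : G)) hd, ← he₀, e1,
      chartDeriv_one]
    have : (fun y : G => y * 1) = id := by ext; simp
    rw [this, modelDeriv_id]; rfl
  simp only [Function.comp_apply, add_apply, ContinuousLinearMap.comp_apply,
    ContinuousLinearMap.flip_apply, ContinuousLinearMap.inl_apply, ContinuousLinearMap.inr_apply,
    e1, adjointMap_one, hid, ContinuousLinearMap.comp_zero,
    zero_add, ContinuousLinearMap.id_apply] at huniq
  rw [huniq, add_sub_cancel_right]

variable (I G) in
/-- The bracket of the Lie algebra of `G`, as an operation on the model space. -/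
noncomputable def modelLie (z v : E) : E :=
  @Bracket.bracket (GroupLieAlgebra I G) (GroupLieAlgebra I G) _ z v

/-- The derivative at the identity of the adjoint representation is the Lie bracket. -/
theorem fderiv_adjointMap_chart_eq_modelLie (z v : E) :
    fderiv ℝ (fun x => adjointMap I ((extChartAt I (1 : G)).symm x)) (extChartAt I (1 : G) 1) z v =
      modelLie I G z v := by
  refine (fderiv_adjointMap_chart (I := I) (G := G) z v).trans ?_
  have : IsManifold I 1 G := IsManifold.of_le (n := ∞) (by simp)
  set e₀ := extChartAt I (1 : G) 1 with he₀
  let V : E → E → E := fun v x => fderiv ℝ (chartLaw I G) (x, e₀) (0, v)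
  have hV : ∀ v : E, VectorField.mpullbackWithin 𝓘(ℝ, E) I (extChartAt I (1 : G)).symm
      (mulInvariantVectorField (I := I) (G := G) v) (range I) =ᶠ[𝓝 e₀] V v := by
    intro v
    have hd := eventually_differentiableAt_chartLaw (I := I) (G := G)
    have c1 : ContinuousAt (fun x : E => (x, e₀)) e₀ := by fun_prop
    filter_upwards [(isOpen_extChartAt_target (I := I) (1 : G)).mem_nhds
      (mem_extChartAt_target (I := I) (1 : G)), c1.eventually hd] with x hx h1
    exact mpullbackWithin_mulInvariantVectorField_eq hx h1 v
  have hD : DifferentiableAt ℝ (fderiv ℝ (chartLaw I G)) (e₀, e₀) :=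
    ((contDiffAt_chartLaw (I := I) (G := G)).fderiv_right (m := 1)
      (by rw [one_add_one_eq_two]; exact ENat.LEInfty.out)).differentiableAt (by simp)
  have hdV : ∀ v w : E, fderiv ℝ (V v) e₀ w =
      fderiv ℝ (fderiv ℝ (chartLaw I G)) (e₀, e₀) (w, 0) (0, v) := by
    intro v w
    have hl := (HasFDerivAt.comp (f := fun y : E => (y, e₀)) e₀ hD.hasFDerivAt
      (hasFDerivAt_prodMk_left e₀ e₀)).clm_apply
      (hasFDerivAt_const ((0, v) : E × E) e₀)
    have := congrArg (fun L : E →L[ℝ] E => L w) hl.fderiv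
    simpa using this
  have hV0 : ∀ v : E, V v e₀ = v := by
    intro w
    have hd := (eventually_differentiableAt_chartLaw (I := I) (G := G)).self_of_nhds
    have e1 : (extChartAt I (1 : G)).symm e₀ = 1 := extChartAt_to_inv _
    change fderiv ℝ (chartLaw I G) (e₀, e₀) (0, w) = w
    rw [fderiv_chartLaw_inr (mem_extChartAt_target (I := I) (1 : G)) hd, ← he₀, e1,
      chartDeriv_one]
    have : (fun y : G => 1 * y) = id := by ext; simp
    rw [this, modelDeriv_id]; rfl
  have hsymm : IsSymmSndFDerivAt ℝ (chartLaw I G) (e₀, e₀) :=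
    (contDiffAt_chartLaw (I := I) (G := G)).isSymmSndFDerivAt
      (by simpa using ENat.LEInfty.out)
  have hb : modelLie I G z v = VectorField.lieBracket ℝ (V z) (V v) e₀ := by
    refine (GroupLieAlgebra.bracket_def (I := I) (G := G) z v).trans ?_
    rw [← VectorField.mlieBracketWithin_univ, VectorField.mlieBracketWithin_apply]
    have h1 : (mfderiv I 𝓘(ℝ, E) (extChartAt I (1 : G)) 1).inverse =
        ContinuousLinearMap.id ℝ E := by
      rw [mfderiv_extChartAt_self]; exact ContinuousLinearMap.inverse_id
    refine (congrArg (fun L : E →L[ℝ] E => L _) h1).trans ?_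
    change VectorField.lieBracketWithin ℝ _ _ _ e₀ = _
    rw [preimage_univ, univ_inter]
    refine ((hV z).lieBracketWithin_vectorField_eq_nhds (hV v)).trans ?_
    rw [I.range_eq_univ, VectorField.lieBracketWithin_univ]
  refine Eq.trans ?_ hb.symm
  rw [VectorField.lieBracket_eq]
  change _ = fderiv ℝ (V v) e₀ (V z e₀) - fderiv ℝ (V z) e₀ (V v e₀)
  rw [hV0, hV0, hdV, hdV]
  congr 1
  exact hsymm _ _

end ChartLaw

section AdjointInvariance

variable {E : Type*} [NormedAddCommGroup E] [NormedSpace ℝ E]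
  {H : Type*} [TopologicalSpace H] {I : ModelWithCorners ℝ E H}
  {G : Type*} [TopologicalSpace G] [ChartedSpace H G] [Group G]
  [I.Boundaryless] [LieGroup I ∞ G]

/-- Derivative at the identity of a function of the adjoint representation. -/
theorem hasMFDerivAt_comp_adjointMap {F : Type*} [NormedAddCommGroup F] [NormedSpace ℝ F]
    {Q : (E →L[ℝ] E) → F} {Q' : (E →L[ℝ] E) →L[ℝ] F}
    (hQ : HasFDerivAt Q Q' (ContinuousLinearMap.id ℝ E)) :
    HasMFDerivAt I 𝓘(ℝ, F) (fun g : G => Q (adjointMap I g)) 1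
      (Q' ∘L fderiv ℝ (fun x => adjointMap I ((extChartAt I (1 : G)).symm x))
        (extChartAt I (1 : G) 1)) := by
  have hA : MDifferentiableAt I 𝓘(ℝ, E →L[ℝ] E) (adjointMap I) (1 : G) :=
    (contMDiff_adjointMap (I := I) (G := G)).mdifferentiable (by simp) 1
  have h1 : HasMFDerivAt I 𝓘(ℝ, E →L[ℝ] E) (adjointMap I) (1 : G)
      (fderiv ℝ (fun x => adjointMap I ((extChartAt I (1 : G)).symm x))
        (extChartAt I (1 : G) 1)) := by
    have h := hA.hasMFDerivAt
    have e : (mfderiv I 𝓘(ℝ, E →L[ℝ] E) (adjointMap I) (1 : G) : E →L[ℝ] E →L[ℝ] E) =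
        fderiv ℝ (fun x => adjointMap I ((extChartAt I (1 : G)).symm x))
          (extChartAt I (1 : G) 1) := by
      refine (if_pos hA).trans ?_
      rw [I.range_eq_univ]
      exact congrFun (fderivWithin_univ (𝕜 := ℝ)
        (f := fun x => adjointMap I ((extChartAt I (1 : G)).symm x))) _
    exact e ▸ h
  have h2 : HasMFDerivAt 𝓘(ℝ, E →L[ℝ] E) 𝓘(ℝ, F) Q (adjointMap I (1 : G)) Q' := by
    rw [adjointMap_one]
    exact hQ.hasMFDerivAt
  exact HasMFDerivAt.comp (f := adjointMap I) (1 : G) h2 h1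

/-- A bilinear form invariant under the adjoint representation is invariant for the bracket. -/
theorem bilin_lie_add_eq_zero [FiniteDimensional ℝ E]
    (B : E →ₗ[ℝ] E →ₗ[ℝ] ℝ)
    (hB : ∀ (g : G) (x y : E), B (adjointMap I g x) (adjointMap I g y) = B x y)
    (z x y : E) : B (modelLie I G z x) y + B x (modelLie I G z y) = 0 := by
  let Bc : E →L[ℝ] E →L[ℝ] ℝ :=
    LinearMap.toContinuousLinearMap (LinearMap.toContinuousLinearMap.toLinearMap ∘ₗ B)
  have hBc : ∀ u v : E, Bc u v = B u v := fun u v => rfl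
  have hQ : HasFDerivAt (fun A : E →L[ℝ] E => Bc (A x) (A y))
      _ (ContinuousLinearMap.id ℝ E) :=
    (Bc.hasFDerivAt.comp _ ((ContinuousLinearMap.apply ℝ E x).hasFDerivAt)).clm_apply
      (ContinuousLinearMap.apply ℝ E y).hasFDerivAt
  have h1 := hasMFDerivAt_comp_adjointMap (I := I) (G := G) hQ
  have h2 : HasMFDerivAt I 𝓘(ℝ, ℝ) (fun g : G => Bc (adjointMap I g x) (adjointMap I g y)) 1
      (0 : E →L[ℝ] ℝ) := by
    have : (fun g : G => Bc (adjointMap I g x) (adjointMap I g y)) = fun _ => Bc x y := by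
      funext g; exact hB g x y
    rw [this]
    exact hasMFDerivAt_const _ _
  have h3 := congrArg (fun L : E →L[ℝ] ℝ => L z) (hasMFDerivAt_unique h1 h2)
  have hx := fderiv_adjointMap_chart_eq_modelLie (I := I) (G := G) z x
  have hy := fderiv_adjointMap_chart_eq_modelLie (I := I) (G := G) z y
  simp only [ContinuousLinearMap.apply_apply, Function.comp_apply, zero_apply,
    ContinuousLinearMap.id_apply] at h3
  rw [← hx, ← hy, ← hBc, ← hBc, add_comm]
  exact h3

/-- On a connected Lie group, a linear form killing all brackets is fixed by the adjoint
representation. -/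
theorem apply_adjointMap_eq_of_lie [FiniteDimensional ℝ E] [ConnectedSpace G]
    (l : E →ₗ[ℝ] ℝ) (hl : ∀ x y : E, l (modelLie I G x y) = 0)
    (g : G) (v : E) : l (adjointMap I g v) = l v := by
  have : IsManifold I 1 G := IsManifold.of_le (n := ∞) (by simp)
  let lc : E →L[ℝ] ℝ := LinearMap.toContinuousLinearMap l
  have hd : ∀ g : G, HasMFDerivAt I 𝓘(ℝ, ℝ) (fun h : G => lc (adjointMap I h v)) g
      (0 : E →L[ℝ] ℝ) := by
    intro g
    have hQ : HasFDerivAt (fun A : E →L[ℝ] E => lc (A (adjointMap I g v)))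
        (lc ∘L ContinuousLinearMap.apply ℝ E (adjointMap I g v)) (ContinuousLinearMap.id ℝ E) :=
      (lc ∘L ContinuousLinearMap.apply ℝ E (adjointMap I g v)).hasFDerivAt
    have h1 := hasMFDerivAt_comp_adjointMap (I := I) (G := G) hQ
    have h0 : ((lc ∘L ContinuousLinearMap.apply ℝ E (adjointMap I g v)) ∘L
        fderiv ℝ (fun x => adjointMap I ((extChartAt I (1 : G)).symm x))
          (extChartAt I (1 : G) 1)) = (0 : E →L[ℝ] ℝ) := by
      ext z
      change l (fderiv ℝ (fun x => adjointMap I ((extChartAt I (1 : G)).symm x))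
          (extChartAt I (1 : G) 1) z (adjointMap I g v)) = 0
      rw [fderiv_adjointMap_chart_eq_modelLie]
      exact hl z _
    have h2 : ∀ k : G, k = 1 → HasMFDerivAt I 𝓘(ℝ, ℝ)
        (fun h : G => lc (adjointMap I h (adjointMap I g v))) k (0 : E →L[ℝ] ℝ) := by
      rintro _ rfl; exact h0 ▸ h1
    have h3 := (h2 (g * g⁻¹) (mul_inv_cancel g)).comp g
      (mdifferentiableAt_mul_right' (I := I) g⁻¹ g).hasMFDerivAt
    have e : (fun h : G => lc (adjointMap I h (adjointMap I g v))) ∘ (fun h => h * g⁻¹) =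
        fun h => lc (adjointMap I h v) := by
      funext h
      have := adjointMap_mul (I := I) (h * g⁻¹) g
      rw [inv_mul_cancel_right] at this
      simp [this]
    rw [e] at h3
    convert! h3
  have hconst := (isLocallyConstant_of_mfderiv_eq_zero (I := I)
    (f := fun h : G => lc (adjointMap I h v)) (fun g => (hd g).mdifferentiableAt)
    (fun g => (hd g).mfderiv)).apply_eq_of_isPreconnected isPreconnected_univ
    (mem_univ g) (mem_univ 1)
  rw [adjointMap_one] at hconst
  exact hconst

end AdjointInvariance

section InvariantForms

variable {E : Type*} [NormedAddCommGroup E] [NormedSpace ℝ E]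
  {H : Type*} [TopologicalSpace H] {I : ModelWithCorners ℝ E H}
  {G : Type*} [TopologicalSpace G] [ChartedSpace H G] [Group G] [LieGroup I ∞ G]

/-- The value of a form at a point, as an alternating map on the model space. -/
noncomputable def SmoothForm.modelVal {k : ℕ} (η : SmoothForm I G k) (x : G) : E [⋀^Fin k]→L[ℝ] ℝ := η x

theorem biInvariantForms.apply_modelDeriv_mul_left {k : ℕ} (η : biInvariantForms I G k) (g x : G)
    (v : Fin k → E) :
    η.1.modelVal (g * x) (fun i => modelDeriv I (fun y => g * y) x (v i)) = η.1.modelVal x v :=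
  congrArg (fun τ : E [⋀^Fin k]→L[ℝ] ℝ => τ v) ((η.2 g).1 x)

theorem biInvariantForms.apply_modelDeriv_mul_right {k : ℕ} (η : biInvariantForms I G k) (g x : G)
    (v : Fin k → E) :
    η.1.modelVal (x * g) (fun i => modelDeriv I (fun y => y * g) x (v i)) = η.1.modelVal x v :=
  congrArg (fun τ : E [⋀^Fin k]→L[ℝ] ℝ => τ v) ((η.2 g).2 x)

theorem biInvariantForms.apply_adjointMap {k : ℕ} (η : biInvariantForms I G k) (g : G)
    (v : Fin k → E) :
    η.1.modelVal 1 (fun i => adjointMap I g (v i)) = η.1.modelVal 1 v := by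
  rw [← apply_modelDeriv_mul_left η g 1 v, ← apply_modelDeriv_mul_right η g 1,
    modelDeriv_mul_left_eq_comp_adjointMap]
  simp

/-- A bi-invariant form is determined by its value at the identity. -/
theorem biInvariantForms.ext_one {k : ℕ} {η θ : biInvariantForms I G k}
    (h : η.1.modelVal 1 = θ.1.modelVal 1) : η = θ := by
  apply Subtype.ext
  apply ContMDiffSection.ext
  intro x
  change η.1.modelVal x = θ.1.modelVal x
  ext v
  rw [← apply_modelDeriv_mul_left η x⁻¹ x v, ← apply_modelDeriv_mul_left θ x⁻¹ x v,
    inv_mul_cancel, h]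

theorem contDiff_compContinuousLinearMap_right [FiniteDimensional ℝ E] {k : ℕ}
    (τ : E [⋀^Fin k]→L[ℝ] ℝ) :
    ContDiff ℝ ∞ (fun A : E →L[ℝ] E => τ.compContinuousLinearMap A) := by
  let T := ContinuousAlternatingMap.toContinuousMultilinearMapCLM ℝ (𝕜 := ℝ) (E := E) (F := ℝ)
    (ι := Fin k)
  have hfin : FiniteDimensional ℝ (ContinuousMultilinearMap ℝ (fun _ : Fin k => E) ℝ) :=
    FiniteDimensional.of_injective
      ({ toFun := fun f => f.toMultilinearMap
         map_add' := fun _ _ => rfl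
         map_smul' := fun _ _ => rfl } : ContinuousMultilinearMap ℝ (fun _ : Fin k => E) ℝ →ₗ[ℝ]
          MultilinearMap ℝ (fun _ : Fin k => E) ℝ)
      ContinuousMultilinearMap.toMultilinearMap_injective
  obtain ⟨S, hS⟩ := LinearMap.exists_leftInverse_of_injective T.toLinearMap
    (LinearMap.ker_eq_bot.2 ContinuousAlternatingMap.toContinuousMultilinearMap_injective)
  have h1 : ContDiff ℝ ∞ (fun A : E →L[ℝ] E =>
      τ.toContinuousMultilinearMap.compContinuousLinearMap fun _ => A) := by
    have h2 : ContDiff ℝ ∞ (fun m : Fin k → E →L[ℝ] E =>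
        ContinuousMultilinearMap.compContinuousLinearMapContinuousMultilinear ℝ
          (fun _ : Fin k => E) (fun _ : Fin k => E) ℝ m) := ContinuousMultilinearMap.contDiff _
    have h3 : ContDiff ℝ ∞ (fun A : E →L[ℝ] E => (fun _ : Fin k => A)) := by fun_prop
    exact (h2.comp h3).clm_apply contDiff_const
  have h4 := (LinearMap.toContinuousLinearMap S).contDiff.comp h1
  convert! h4 using 2 with A
  exact (LinearMap.congr_fun hS (τ.compContinuousLinearMap A)).symm

theorem modelDeriv_inv_mul_mul (x y : G) :
    modelDeriv I (fun z => (x * y)⁻¹ * z) (x * y) ∘L modelDeriv I (fun z => x * z) y =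
      modelDeriv I (fun z => y⁻¹ * z) y := by
  rw [← modelDeriv_comp _ (mdifferentiableAt_mul_left' _ _) (mdifferentiableAt_mul_left' _ _)]
  congr 1
  ext z
  simp [mul_assoc]

theorem modelDeriv_inv_mul_mul_right (x g : G) :
    modelDeriv I (fun z => (x * g)⁻¹ * z) (x * g) ∘L modelDeriv I (fun z => z * g) x =
      adjointMap I g⁻¹ ∘L modelDeriv I (fun z => x⁻¹ * z) x := by
  rw [← modelDeriv_comp _ (mdifferentiableAt_mul_left' _ _) (mdifferentiableAt_mul_right' _ _),
    adjointMap, ← inv_mul_cancel x,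
    ← modelDeriv_comp _ (mdifferentiableAt_conj _ _) (mdifferentiableAt_mul_left' _ _)]
  congr 1
  ext z
  simp [mul_assoc]

variable (I) in
/-- The value at `x` of the left-invariant form with value `τ` at the identity. -/
noncomputable def leftInvariantVal {k : ℕ} (τ : E [⋀^Fin k]→L[ℝ] ℝ) (x : G) :
    E [⋀^Fin k]→L[ℝ] ℝ :=
  τ.compContinuousLinearMap (modelDeriv I (fun y => x⁻¹ * y) x)

theorem contMDiff_leftInvariantVal [FiniteDimensional ℝ E] {k : ℕ} (τ : E [⋀^Fin k]→L[ℝ] ℝ) :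
    ContMDiff I (I.prod 𝓘(ℝ, E [⋀^Fin k]→L[ℝ] ℝ)) ∞ (fun x : G =>
      (⟨x, leftInvariantVal (E := E) I τ x⟩ :
        Bundle.TotalSpace (E [⋀^Fin k]→L[ℝ] ℝ)
          (fun x : G => TangentSpace I x [⋀^Fin k]→L[ℝ] Bundle.Trivial G ℝ x))) := by
  have : IsManifold I 1 G := IsManifold.of_le (n := ∞) (by simp)
  intro x₀
  rw [Bundle.contMDiffAt_totalSpace]
  refine ⟨contMDiffAt_id, ?_⟩
  have hf : ContMDiffAt (I.prod I) I ∞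
      (Function.uncurry fun (x y : G) => x⁻¹ * y) (x₀, x₀) := by
    have h1 : ContMDiff (I.prod I) I ∞ (fun p : G × G => p.1⁻¹ * p.2) :=
      contMDiff_fst.inv.mul contMDiff_snd
    exact h1.contMDiffAt
  have h1 := ContMDiffAt.mfderiv (m := ∞) (fun (x y : G) => x⁻¹ * y) id hf
    contMDiffAt_id (by simp)
  have h2 := (contDiff_compContinuousLinearMap_right τ).contMDiff.contMDiffAt.comp x₀ h1
  refine h2.congr_of_eventuallyEq (Eventually.of_forall fun x => ?_)
  have key : ∀ h k : G, h = 1 → k = 1 →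
      ((trivializationAt E (TangentSpace I) k).continuousLinearMapAt ℝ h : E →L[ℝ] E) =
        ContinuousLinearMap.id ℝ E := by
    rintro _ _ rfl rfl; exact continuousLinearMapAt_trivializationAt_self _
  ext v
  refine Eq.symm ?_
  refine (congrArg (fun L : E →L[ℝ] E => τ (fun i => L
    (modelDeriv I (fun y => x⁻¹ * y) x
      ((trivializationAt E (TangentSpace I) x₀).symmL ℝ x (v i) : E))))
    (key (x⁻¹ * x) (x₀⁻¹ * x₀) (by simp) (by simp))).trans ?_
  have htriv : ((trivializationAt ℝ (Bundle.Trivial G ℝ) x₀).continuousLinearMapAt ℝ x :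
      ℝ →L[ℝ] ℝ) = ContinuousLinearMap.id ℝ ℝ :=
    Bundle.Trivial.continuousLinearMapAt_trivialization ℝ G ℝ x
  exact (congrArg (fun L : ℝ →L[ℝ] ℝ => L (leftInvariantVal I τ x (fun i =>
    ((trivializationAt E (TangentSpace I) x₀).symmL ℝ x (v i) : E)))) htriv).symm

/-- The bi-invariant form with a given `Ad`-invariant value at the identity. -/
noncomputable def biInvariantForms.ofAdjointInvariant [FiniteDimensional ℝ E] {k : ℕ}
    (τ : E [⋀^Fin k]→L[ℝ] ℝ)
    (hτ : ∀ (g : G) (v : Fin k → E), τ (fun i => adjointMap I g (v i)) = τ v) :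
    biInvariantForms I G k :=
  ⟨⟨fun x => leftInvariantVal (E := E) I τ x,
    contMDiff_leftInvariantVal τ⟩, fun g => ⟨fun x => by
      ext v
      exact congrArg (fun L : E →L[ℝ] E => τ (fun i => L (v i))) (modelDeriv_inv_mul_mul g x),
    fun x => by
      ext v
      refine (congrArg (fun L : E →L[ℝ] E => τ (fun i => L (v i)))
        (modelDeriv_inv_mul_mul_right x g)).trans ?_
      exact hτ g⁻¹ _⟩⟩

theorem biInvariantForms.ofAdjointInvariant_modelVal_one [FiniteDimensional ℝ E] {k : ℕ}
    (τ : E [⋀^Fin k]→L[ℝ] ℝ)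
    (hτ : ∀ (g : G) (v : Fin k → E), τ (fun i => adjointMap I g (v i)) = τ v) :
    (biInvariantForms.ofAdjointInvariant τ hτ).1.modelVal 1 = τ := by
  ext v
  have h : modelDeriv I (fun y : G => 1⁻¹ * y) 1 = ContinuousLinearMap.id ℝ E := by
    have : (fun y : G => 1⁻¹ * y) = id := by ext; simp
    rw [this, modelDeriv_id]
  exact congrArg (fun L : E →L[ℝ] E => τ (fun i => L (v i))) h

end InvariantForms

section LieAlgebra

variable {L : Type*} [LieRing L] [LieAlgebra ℝ L]

omit [LieAlgebra ℝ L] in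
/-- An invariant alternating bilinear form vanishes on brackets. -/
theorem eq_zero_of_invariant_of_alternating (B : L → L → ℝ) (hanti : ∀ x y, B x y = -B y x)
    (hneg : ∀ x y, B (-x) y = -B x y) (hinv : ∀ z x y : L, B ⁅z, x⁆ y + B x ⁅z, y⁆ = 0) (z x y : L) :
    B ⁅z, x⁆ y = 0 := by
  have h1 : ∀ z x y, B ⁅z, x⁆ y = B ⁅z, y⁆ x := fun z x y => by
    linarith [hinv z x y, hanti x ⁅z, y⁆]
  have h2 : ∀ z x y, B ⁅z, x⁆ y = -B ⁅x, z⁆ y := fun z x y => by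
    rw [← lie_skew, hneg]
  linarith [h1 z x y, h2 z y x, h1 y z x, h2 y x z, h1 x y z, h2 x z y]

theorem apply_eq_zero_of_mem_lieCommutator (l : L →ₗ[ℝ] ℝ) (hl : ∀ x y : L, l ⁅x, y⁆ = 0)
    {v : L} (hv : v ∈ lieCommutator L) : l v = 0 := by
  have h : (lieCommutator L).toSubmodule ≤ LinearMap.ker l := by
    rw [lieCommutator, LieSubmodule.lieIdeal_oper_eq_linear_span', Submodule.span_le]
    rintro _ ⟨x, -, y, -, rfl⟩
    exact hl x y
  exact h hv

theorem lie_mem_lieCommutator (x y : L) : ⁅x, y⁆ ∈ lieCommutator L :=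
  LieSubmodule.lie_mem_lie (LieSubmodule.mem_top x) (LieSubmodule.mem_top y)

/-- An abelian direct summand is central. -/
theorem IsAbelianDirectSummand.le_center {𝔟 : LieIdeal ℝ L} (h : IsAbelianDirectSummand 𝔟) :
    𝔟 ≤ LieAlgebra.center ℝ L := by
  obtain ⟨hab, 𝔠, hc⟩ := h
  intro b hb
  rw [LieModule.mem_maxTrivSubmodule]
  intro x
  have hx : x ∈ 𝔟 ⊔ 𝔠 := by rw [hc.sup_eq_top]; exact LieSubmodule.mem_top x
  obtain ⟨y, hy, z, hz, rfl⟩ := (LieSubmodule.mem_sup 𝔟 𝔠 x).1 hx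
  have h1 : ⁅y, b⁆ = 0 :=
    congrArg Subtype.val (hab.trivial (⟨y, hy⟩ : 𝔟) (⟨b, hb⟩ : 𝔟))
  have h2 : ⁅z, b⁆ = 0 := by
    have hm : ⁅z, b⁆ ∈ 𝔟 ⊓ 𝔠 :=
      ⟨lie_mem_right ℝ L 𝔟 z b hb, lie_mem_left ℝ L 𝔠 z b hz⟩
    rw [hc.inf_eq_bot] at hm
    exact (LieSubmodule.mem_bot _).1 hm
  rw [add_lie, h1, h2, add_zero]

/-- If the centre is a complement of the commutator ideal, it is the largest abelian direct summand
and it is isomorphic to the abelianisation. -/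
theorem exists_isGreatest_abelianDirectSummand
    (h : IsCompl (LieAlgebra.center ℝ L) (lieCommutator L)) :
    ∃ 𝔷 : LieIdeal ℝ L, IsGreatest {𝔟 : LieIdeal ℝ L | IsAbelianDirectSummand 𝔟} 𝔷 ∧
      ∃ e : 𝔷 ≃ₗ⁅ℝ⁆ LieAb L, ∀ x : 𝔷, e x = LieAb.mk (x : L) := by
  refine ⟨LieAlgebra.center ℝ L, ⟨⟨inferInstance, _, h⟩, fun 𝔟 hb => hb.le_center⟩, ?_⟩
  let f : LieAlgebra.center ℝ L →ₗ⁅ℝ⁆ LieAb L :=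
    { toFun := fun x => LieAb.mk (x : L)
      map_add' := fun _ _ => rfl
      map_smul' := fun _ _ => rfl
      map_lie' := fun {_ _} => rfl }
  refine ⟨LieEquiv.ofBijective f ⟨?_, ?_⟩, fun x => rfl⟩
  · intro x y hxy
    have h1 : (x : L) - y ∈ lieCommutator L := (Submodule.Quotient.eq _).1 hxy
    have h2 : (x : L) - y ∈ LieAlgebra.center ℝ L ⊓ lieCommutator L :=
      ⟨(x - y).2, h1⟩
    rw [h.inf_eq_bot] at h2
    exact Subtype.ext (sub_eq_zero.1 ((LieSubmodule.mem_bot _).1 h2))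
  · intro q
    obtain ⟨x, rfl⟩ := LieSubmodule.Quotient.surjective_mk' (lieCommutator L) q
    have hx : x ∈ LieAlgebra.center ℝ L ⊔ lieCommutator L := by
      rw [h.sup_eq_top]; exact LieSubmodule.mem_top x
    obtain ⟨y, hy, z, hz, rfl⟩ := (LieSubmodule.mem_sup _ _ x).1 hx
    refine ⟨⟨y, hy⟩, (Submodule.Quotient.eq _).2 ?_⟩
    have : y - (y + z) = -z := by abel
    rw [this]
    exact neg_mem hz

/-- With an invariant inner product, the centre is the orthogonal complement of the commutator
ideal. -/
theorem isCompl_center_lieCommutator [FiniteDimensional ℝ L] (B : LinearMap.BilinForm ℝ L)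
    (hsymm : ∀ x y, B x y = B y x) (hpos : ∀ x, B x x = 0 → x = 0)
    (hinv : ∀ z x y : L, B ⁅z, x⁆ y + B x ⁅z, y⁆ = 0) :
    IsCompl (LieAlgebra.center ℝ L) (lieCommutator L) := by
  have hc : (LieAlgebra.center ℝ L).toSubmodule = B.orthogonal (lieCommutator L).toSubmodule := by
    ext x
    rw [LieSubmodule.mem_toSubmodule, LieModule.mem_maxTrivSubmodule,
      LinearMap.BilinForm.mem_orthogonal_iff]
    constructor
    · intro hx v hv
      refine apply_eq_zero_of_mem_lieCommutator (B.flip x) (fun y z => ?_) hv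
      have := hinv y z x
      rw [hx y] at this
      simpa using this
    · intro hx z
      apply hpos
      have h1 : B ⁅z, ⁅z, x⁆⁆ x = 0 := hx _ (lie_mem_lieCommutator _ _)
      linarith [hinv z ⁅z, x⁆ x]
  rw [← LieSubmodule.isCompl_toSubmodule, hc]
  refine (LinearMap.BilinForm.isCompl_orthogonal_of_restrict_nondegenerate
    (fun x y h => (hsymm y x).trans h) ?_).symm
  have hr : (B.restrict (lieCommutator L).toSubmodule).IsRefl := fun x y h => (hsymm y x).trans h
  rw [LinearMap.BilinForm.Nondegenerate, hr.nondegenerate_iff_separatingLeft]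
  exact fun x hx => Subtype.ext (hpos _ (hx x))

end LieAlgebra

section ExteriorPower

theorem exteriorPower.pairingDual_bijective (V : Type*) [AddCommGroup V] [Module ℝ V]
    [FiniteDimensional ℝ V] (n : ℕ) :
    Function.Bijective (exteriorPower.pairingDual ℝ V n) := by
  classical
  let b := Module.finBasis ℝ V
  let c := b.dualBasis.exteriorPower n
  let d := (b.exteriorPower n).dualBasis
  have h : ∀ s, exteriorPower.pairingDual ℝ V n (c s) = d s := by
    intro s
    rw [exteriorPower.basis_apply]
    have h1 : d s = (b.exteriorPower n).coord s := by
      simp [d]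
    rw [h1, exteriorPower.basis_coord, exteriorPower.ιMultiDual, b.coe_dualBasis]
  have e : exteriorPower.pairingDual ℝ V n = (c.equiv d (Equiv.refl _)).toLinearMap :=
    c.ext fun s => by simp [h]
  rw [e]
  exact (c.equiv d (Equiv.refl _)).bijective

/-- Two linear injections with the same range differ by a linear equivalence. -/
theorem LinearEquiv.exists_of_range_eq {R A B C : Type*} [Ring R] [AddCommGroup A] [Module R A]
    [AddCommGroup B] [Module R B] [AddCommGroup C] [Module R C] (S : A →ₗ[R] C) (T : B →ₗ[R] C)
    (hS : Function.Injective S) (hT : Function.Injective T)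
    (h : LinearMap.range S = LinearMap.range T) :
    ∃ Φ : A ≃ₗ[R] B, ∀ a, T (Φ a) = S a := by
  refine ⟨(LinearEquiv.ofInjective S hS).trans ((LinearEquiv.ofEq _ _ h).trans
    (LinearEquiv.ofInjective T hT).symm), fun a => ?_⟩
  have := congrArg Subtype.val ((LinearEquiv.ofInjective T hT).apply_symm_apply
    (LinearEquiv.ofEq _ _ h (LinearEquiv.ofInjective S hS a)))
  exact this

end ExteriorPower

section Averaging

variable {E : Type*} [NormedAddCommGroup E] [NormedSpace ℝ E] [FiniteDimensional ℝ E]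
  {H : Type*} [TopologicalSpace H] {I : ModelWithCorners ℝ E H}
  {G : Type*} [TopologicalSpace G] [ChartedSpace H G] [Group G] [LieGroup I ∞ G]

open MeasureTheory in
variable (I G) in
/-- A compact Lie group has an `Ad`-invariant inner product on its Lie algebra. -/
theorem exists_adjointMap_invariant_inner [CompactSpace G] :
    ∃ B : LinearMap.BilinForm ℝ E, (∀ x y, B x y = B y x) ∧ (∀ x, B x x = 0 → x = 0) ∧
      ∀ (g : G) (x y : E), B (adjointMap I g x) (adjointMap I g y) = B x y := by
  have : IsTopologicalGroup G := topologicalGroup_of_lieGroup I ∞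
  borelize G
  let μ : Measure G := Measure.haar
  let b := Module.finBasis ℝ E
  let f : E → E → G → ℝ := fun x y g =>
    ∑ i, b.repr (adjointMap I g⁻¹ x) i * b.repr (adjointMap I g⁻¹ y) i
  have hc1 : ∀ x i, Continuous fun g : G => b.repr (adjointMap I g⁻¹ x) i := by
    intro x i
    have h1 : Continuous fun g : G => adjointMap I g⁻¹ x :=
      ((contMDiff_adjointMap (I := I) (G := G)).continuous.comp continuous_inv).clm_apply
        continuous_const
    exact (LinearMap.continuous_of_finiteDimensional (b.coord i)).comp h1
  have hc : ∀ x y, Continuous (f x y) := fun x y =>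
    continuous_finsetSum _ fun i _ => (hc1 x i).mul (hc1 y i)
  have hint : ∀ x y, Integrable (f x y) μ := fun x y =>
    (hc x y).integrable_of_hasCompactSupport (HasCompactSupport.of_compactSpace _)
  let B : LinearMap.BilinForm ℝ E := LinearMap.mk₂ ℝ (fun x y => ∫ g, f x y g ∂μ)
    (fun x x' y => by
      rw [← integral_add (hint _ _) (hint _ _)]
      congr 1; ext g; simp [f, add_mul, Finset.sum_add_distrib])
    (fun c x y => by
      rw [smul_eq_mul, ← integral_const_mul]
      congr 1; ext g; simp [f, Finset.mul_sum, mul_assoc])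
    (fun x y y' => by
      rw [← integral_add (hint _ _) (hint _ _)]
      congr 1; ext g; simp [f, mul_add, Finset.sum_add_distrib])
    (fun c x y => by
      rw [smul_eq_mul, ← integral_const_mul]
      congr 1; ext g; simp [f, Finset.mul_sum, mul_left_comm])
  refine ⟨B, fun x y => ?_, fun x hx => ?_, fun g x y => ?_⟩
  · change ∫ g, f x y g ∂μ = ∫ g, f y x g ∂μ
    congr 1; ext g; simp [f, mul_comm]
  · have hx' : ∫ g, f x x g ∂μ = 0 := hx
    have hnn : 0 ≤ f x x := fun g => Finset.sum_nonneg fun i _ => mul_self_nonneg _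
    rw [integral_eq_zero_iff_of_nonneg hnn (hint x x),
      (hc x x).ae_eq_iff_eq μ continuous_zero] at hx'
    have h1 : ∑ i, b.repr x i * b.repr x i = 0 := by
      have := congrFun hx' 1
      simpa [f, adjointMap_one] using this
    apply b.ext_elem
    intro i
    have := (Finset.sum_eq_zero_iff_of_nonneg fun i _ => mul_self_nonneg (b.repr x i)).1 h1 i
      (Finset.mem_univ i)
    simpa using this
  · change ∫ h, f (adjointMap I g x) (adjointMap I g y) h ∂μ = ∫ h, f x y h ∂μ
    rw [← integral_mul_left_eq_self (f x y) g⁻¹]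
    congr 1; ext h
    have := adjointMap_mul (I := I) h⁻¹ g
    simp [f, this]

end Averaging

section Main

variable {E : Type*} [NormedAddCommGroup E] [NormedSpace ℝ E] [FiniteDimensional ℝ E]
  {H : Type*} [TopologicalSpace H] {I : ModelWithCorners ℝ E H} [I.Boundaryless]
  {G : Type*} [TopologicalSpace G] [ChartedSpace H G] [Group G] [LieGroup I ∞ G]

instance : FiniteDimensional ℝ (GroupLieAlgebra I G) := inferInstanceAs (FiniteDimensional ℝ E)

variable (I G) in
/-- The value at the identity of a bi-invariant `2`-form, as a function of two vectors. -/
noncomputable def biInvariantForms.evalOne :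
    biInvariantForms I G 2 →ₗ[ℝ] (GroupLieAlgebra I G → GroupLieAlgebra I G → ℝ) where
  toFun η X Y := η.1 1 ![X, Y]
  map_add' _ _ := rfl
  map_smul' _ _ := rfl

/-- An element of the second exterior power of the dual of the abelianisation, as a function of
two vectors of the Lie algebra. -/
noncomputable def exteriorLieAbEval (L : Type*) [LieRing L] [LieAlgebra ℝ L] :
    ⋀[ℝ]^2 (Module.Dual ℝ (LieAb L)) →ₗ[ℝ] (L → L → ℝ) where
  toFun θ X Y := exteriorPower.pairingDual ℝ (LieAb L) 2 θ
    (exteriorPower.ιMulti ℝ 2 ![LieAb.mk X, LieAb.mk Y])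
  map_add' _ _ := by ext; simp
  map_smul' _ _ := by ext; simp

theorem exteriorLieAbEval_injective (L : Type*) [LieRing L] [LieAlgebra ℝ L]
    [FiniteDimensional ℝ L] : Function.Injective (exteriorLieAbEval L) := by
  intro θ θ' h
  apply (exteriorPower.pairingDual_bijective (LieAb L) 2).1
  apply exteriorPower.linearMap_ext
  ext v
  obtain ⟨X, hX⟩ := LieSubmodule.Quotient.surjective_mk' (lieCommutator L) (v 0)
  obtain ⟨Y, hY⟩ := LieSubmodule.Quotient.surjective_mk' (lieCommutator L) (v 1)
  have hv : v = ![LieAb.mk X, LieAb.mk Y] := by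
    ext i; fin_cases i
    · exact hX.symm
    · exact hY.symm
  rw [hv]
  exact congrFun (congrFun h X) Y

/-- An alternating map in two variables, as a bilinear map. -/
def AlternatingMap.toBilin {V : Type*} [AddCommGroup V] [Module ℝ V] (τ : V [⋀^Fin 2]→ₗ[ℝ] ℝ) :
    V →ₗ[ℝ] V →ₗ[ℝ] ℝ :=
  have hswap : ∀ x y, τ ![x, y] = -τ ![y, x] := fun x y => by
    have := τ.map_swap ![y, x] (i := 0) (j := 1) (by decide)
    rw [← this]
    congr 1
    ext i; fin_cases i <;> rfl
  LinearMap.mk₂ ℝ (fun x y => τ ![x, y])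
    (fun x x' y => τ.map_vecCons_add ![y] x x')
    (fun c x y => τ.map_vecCons_smul ![y] c x)
    (fun x y y' => by
      rw [hswap x, hswap x y, hswap x y', τ.map_vecCons_add ![x] y y', neg_add])
    (fun c x y => by
      rw [hswap x, hswap x y, τ.map_vecCons_smul ![x] c y, smul_neg])

theorem AlternatingMap.toBilin_apply {V : Type*} [AddCommGroup V] [Module ℝ V]
    (τ : V [⋀^Fin 2]→ₗ[ℝ] ℝ) (x y : V) : τ.toBilin x y = τ ![x, y] := rfl

theorem AlternatingMap.toBilin_swap {V : Type*} [AddCommGroup V] [Module ℝ V]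
    (τ : V [⋀^Fin 2]→ₗ[ℝ] ℝ) (x y : V) : τ.toBilin x y = -τ.toBilin y x := by
  have := τ.map_swap ![y, x] (i := 0) (j := 1) (by decide)
  rw [toBilin_apply, toBilin_apply, ← this]
  congr 1
  ext i; fin_cases i <;> rfl

theorem AlternatingMap.continuous_of_finiteDimensional_fin_two (τ : E [⋀^Fin 2]→ₗ[ℝ] ℝ) :
    Continuous τ := by
  let Bc : E →L[ℝ] E →L[ℝ] ℝ :=
    LinearMap.toContinuousLinearMap (LinearMap.toContinuousLinearMap.toLinearMap ∘ₗ τ.toBilin)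
  have h : (τ : (Fin 2 → E) → ℝ) = fun v => Bc (v 0) (v 1) := by
    funext v
    change τ v = τ ![v 0, v 1]
    congr 1
    ext i; fin_cases i <;> rfl
  rw [h]
  fun_prop

/-- Alternating bilinear forms killing brackets come from the exterior power of the dual of the
abelianisation. -/
theorem toBilin_mem_range_exteriorLieAbEval {L : Type*} [LieRing L] [LieAlgebra ℝ L]
    [FiniteDimensional ℝ L] (τ : L [⋀^Fin 2]→ₗ[ℝ] ℝ) (h : ∀ x y z : L, τ.toBilin ⁅x, y⁆ z = 0) :
    (fun X Y => τ.toBilin X Y) ∈ LinearMap.range (exteriorLieAbEval L) := by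
  let q : L →ₗ[ℝ] LieAb L := (lieCommutator L).toSubmodule.mkQ
  obtain ⟨s, hs⟩ := q.exists_rightInverse_of_surjective
    (LinearMap.range_eq_top.2 (Submodule.mkQ_surjective _))
  obtain ⟨θ, hθ⟩ := (exteriorPower.pairingDual_bijective (LieAb L) 2).2
    (exteriorPower.alternatingMapLinearEquiv (τ.compLinearMap s))
  have hl : ∀ x x' y : L, x - x' ∈ lieCommutator L → τ.toBilin x y = τ.toBilin x' y := by
    intro x x' y hx
    have := apply_eq_zero_of_mem_lieCommutator (τ.toBilin.flip y) (fun a b => h a b y) hx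
    simpa [sub_eq_zero] using this
  have hsx : ∀ X : L, s (LieAb.mk X) - X ∈ lieCommutator L := fun X =>
    (Submodule.Quotient.eq _).1 (LinearMap.congr_fun hs (LieAb.mk X))
  refine ⟨θ, ?_⟩
  funext X Y
  change exteriorPower.pairingDual ℝ (LieAb L) 2 θ _ = _
  rw [hθ, exteriorPower.alternatingMapLinearEquiv_apply_ιMulti, AlternatingMap.compLinearMap_apply,
    ← hl _ _ _ (hsx X), AlternatingMap.toBilin_swap, ← hl _ _ _ (hsx Y),
    ← AlternatingMap.toBilin_swap, AlternatingMap.toBilin_apply]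
  congr 1
  ext i; fin_cases i <;> rfl

omit [FiniteDimensional ℝ E] [I.Boundaryless] in
theorem biInvariantForms.evalOne_injective :
    Function.Injective (biInvariantForms.evalOne I G) := by
  intro η θ h
  apply biInvariantForms.ext_one
  ext v
  have hv : v = ![v 0, v 1] := by ext i; fin_cases i <;> rfl
  rw [hv]
  exact congrFun (congrFun h (v 0)) (v 1)

theorem range_evalOne_eq_range_exteriorLieAbEval [ConnectedSpace G] :
    LinearMap.range (biInvariantForms.evalOne I G) =
      LinearMap.range (exteriorLieAbEval (GroupLieAlgebra I G)) := by
  apply le_antisymm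
  · rintro _ ⟨η, rfl⟩
    let τ : E [⋀^Fin 2]→ₗ[ℝ] ℝ := (η.1.modelVal 1).toAlternatingMap
    have hinv : ∀ (g : G) (x y : E),
        τ.toBilin (adjointMap I g x) (adjointMap I g y) = τ.toBilin x y := by
      intro g x y
      have := biInvariantForms.apply_adjointMap η g ![x, y]
      refine Eq.trans ?_ this
      change η.1.modelVal 1 _ = _
      congr 1
      ext i; fin_cases i <;> rfl
    have h0 := eq_zero_of_invariant_of_alternating (L := GroupLieAlgebra I G)
      (fun x y => τ.toBilin x y) (fun x y => τ.toBilin_swap x y)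
      (fun x y => LinearMap.map_neg₂ τ.toBilin x y)
      (fun z x y => bilin_lie_add_eq_zero (I := I) (G := G) τ.toBilin hinv z x y)
    exact toBilin_mem_range_exteriorLieAbEval (L := GroupLieAlgebra I G) τ h0
  · rintro _ ⟨θ, rfl⟩
    let σ : GroupLieAlgebra I G [⋀^Fin 2]→ₗ[ℝ] ℝ :=
      (exteriorPower.alternatingMapLinearEquiv.symm (exteriorPower.pairingDual ℝ _ 2 θ)).compLinearMap
        (lieCommutator (GroupLieAlgebra I G)).toSubmodule.mkQ
    let τ : E [⋀^Fin 2]→ₗ[ℝ] ℝ := σ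
    have hσ : ∀ x y : GroupLieAlgebra I G, σ ![x, y] =
        exteriorLieAbEval (GroupLieAlgebra I G) θ x y := by
      intro x y
      change exteriorPower.pairingDual ℝ _ 2 θ (exteriorPower.ιMulti ℝ 2 _) = _
      congr 2
    have h0 : ∀ x y z : GroupLieAlgebra I G, σ.toBilin ⁅x, y⁆ z = 0 := by
      intro x y z
      refine AlternatingMap.map_coord_zero (exteriorPower.alternatingMapLinearEquiv.symm
        (exteriorPower.pairingDual ℝ (LieAb (GroupLieAlgebra I G)) 2 θ)) 0 ?_
      exact (Submodule.Quotient.mk_eq_zero _).2 (lie_mem_lieCommutator x y)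
    have h1 : ∀ (g : G) (x y : E), τ.toBilin (adjointMap I g x) y = τ.toBilin x y := fun g x y =>
      apply_adjointMap_eq_of_lie (I := I) (G := G) (τ.toBilin.flip y) (fun a b => h0 a b y) g x
    have h2 : ∀ (g : G) (x y : E),
        τ.toBilin (adjointMap I g x) (adjointMap I g y) = τ.toBilin x y := fun g x y => by
      rw [h1, τ.toBilin_swap, h1, ← τ.toBilin_swap]
    let τc : E [⋀^Fin 2]→L[ℝ] ℝ :=
      { τ with cont := τ.continuous_of_finiteDimensional_fin_two }
    have hτ : ∀ (g : G) (v : Fin 2 → E), τc (fun i => adjointMap I g (v i)) = τc v := by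
      intro g v
      have hv : v = ![v 0, v 1] := by ext i; fin_cases i <;> rfl
      refine Eq.trans ?_ ((h2 g (v 0) (v 1)).trans ?_)
      · change τ _ = τ _
        congr 1
        ext i; fin_cases i <;> rfl
      · change τ _ = τ _
        rw [← hv]
    refine ⟨biInvariantForms.ofAdjointInvariant τc hτ, ?_⟩
    funext X Y
    refine Eq.trans ?_ (hσ X Y)
    exact congrArg (fun ρ : E [⋀^Fin 2]→L[ℝ] ℝ => ρ ![X, Y])
      (biInvariantForms.ofAdjointInvariant_modelVal_one (I := I) (G := G) τc hτ)

end Main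
theorem mainTheorem2 {E : Type*} [NormedAddCommGroup E] [NormedSpace ℝ E] [FiniteDimensional ℝ E]
    {H : Type*} [TopologicalSpace H] (I : ModelWithCorners ℝ E H) [I.Boundaryless]
    (G : Type*) [TopologicalSpace G] [ChartedSpace H G] [Group G] [LieGroup I ∞ G]
    [ConnectedSpace G] :
    (∃ Φ : biInvariantForms I G 2 ≃ₗ[ℝ] ⋀[ℝ]^2 (Module.Dual ℝ (LieAb (GroupLieAlgebra I G))),
      ∀ (η : biInvariantForms I G 2) (X Y : GroupLieAlgebra I G),
        exteriorPower.pairingDual ℝ (LieAb (GroupLieAlgebra I G)) 2 (Φ η)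
          (exteriorPower.ιMulti ℝ 2 ![LieAb.mk X, LieAb.mk Y]) = η.1 1 ![X, Y]) ∧
    (CompactSpace G →
      ∃ 𝔷 : LieIdeal ℝ (GroupLieAlgebra I G),
        IsGreatest {𝔟 : LieIdeal ℝ (GroupLieAlgebra I G) | IsAbelianDirectSummand 𝔟} 𝔷 ∧
        ∃ e : 𝔷 ≃ₗ⁅ℝ⁆ LieAb (GroupLieAlgebra I G),
          ∀ x : 𝔷, e x = LieAb.mk (x : GroupLieAlgebra I G)) := by
  constructor
  · obtain ⟨Φ, hΦ⟩ := LinearEquiv.exists_of_range_eq (biInvariantForms.evalOne I G)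
      (exteriorLieAbEval (GroupLieAlgebra I G)) biInvariantForms.evalOne_injective
      (exteriorLieAbEval_injective _) range_evalOne_eq_range_exteriorLieAbEval
    exact ⟨Φ, fun η X Y => congrFun (congrFun (hΦ η) X) Y⟩
  · intro hG
    obtain ⟨B, hsymm, hpos, hB⟩ := exists_adjointMap_invariant_inner I G
    exact exists_isGreatest_abelianDirectSummand (isCompl_center_lieCommutator
      (L := GroupLieAlgebra I G) B hsymm hpos
      fun z x y => bilin_lie_add_eq_zero (I := I) (G := G) B hB z x y)
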